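/- Let $d\ge 1$ be an integer and let $\alpha\in(0,2]$, $\beta\in(0,2)$, $\gamma>0$ and $\nu>0$. For $t>0$ and $x\in\mathbb{R}^d\setminus\{0\}$ let $$Y(t,x)=\pi^{-d/2}\,|x|^{-d}\,t^{\beta+\gamma-1}\,H\!\left(\frac{|x|^{\alpha}}{2^{\alpha-1}\nu t^{\beta}}\right),$$ where $H$ is the Fox H-function $$H(z)=H^{2,1}_{2,3}\left[z\,\middle|\begin{array}{l}(1,1),\ (\beta+\gamma,\beta)\\ (d/2,\alpha/2),\ (1,1),\ (1,\alpha/2)\end{array}\right]=\frac{1}{2\pi i}\int_{c-i\infty}^{c+i\infty}\frac{\Gamma(\tfrac d2+\tfrac\alpha2 s)\,\Gamma(1+s)\,\Gamma(-s)}{\Gamma(\beta+\gamma+\beta s)\,\Gamma(-\tfrac\alpha2 s)}\,z^{-s}\,ds,\qquad z>0,$$ with any $c$ such that $-\min(1,d/\alpha)<c<0$ (the value does not depend on $c$). This is the Green function of $\left(\partial_t^\beta+\frac{\nu}{2}(-\Delta)^{\alpha/2}\right)u=I_t^\gamma f$, where $\partial_t^\beta$ is the Caputo derivative and $I_t^\gamma$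 is the Riemann-Liouville integral. Then the following two conditions are equivalent: (i) $d<2\alpha+\frac{\alpha}{\beta}\min(2\gamma-1,0)$; (ii) $\displaystyle\int_0^t\int_{\mathbb{R}^d}Y(s,y)^2\,dy\,ds<\infty$ for all $t>0$. -/

import Mathlib

open MeasureTheory

noncomputable section

/-- The Mellin symbol of the Fox H-function with real parameters. The list `A` holds the upper
pairs `(a_i, α_i)`, `i = 1, …, p`, the list `B` the lower pairs `(b_j, β_j)`, `j = 1, …, q`:
`∏_{j ≤ m} Γ(b_j + β_j s) ∏_{i ≤ n} Γ(1 - a_i - α_i s)` divided by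
`∏_{i > n} Γ(a_i + α_i s) ∏_{j > m} Γ(1 - b_j - β_j s)`.
(Mathlib's `Γ` is `0` at its poles, so that `1 / Γ` is the entire function it should be.) -/
def foxSymbol (m n : ℕ) (A B : List (ℝ × ℝ)) (s : ℂ) : ℂ :=
  (((B.take m).map fun b => Complex.Gamma ((b.1 : ℂ) + (b.2 : ℂ) * s)).prod *
      ((A.take n).map fun a => Complex.Gamma (1 - (a.1 : ℂ) - (a.2 : ℂ) * s)).prod) /
    (((A.drop n).map fun a => Complex.Gamma ((a.1 : ℂ) + (a.2 : ℂ) * s)).prod *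
      ((B.drop m).map fun b => Complex.Gamma (1 - (b.1 : ℂ) - (b.2 : ℂ) * s)).prod)

/-- The vertical line `Re s = c` separates the poles `-(b_j + l) / β_j` of the factors
`Γ(b_j + β_j s)`, `j ≤ m` (to its left) from the poles `(1 - a_i + k) / α_i` of the factors
`Γ(1 - a_i - α_i s)`, `i ≤ n` (to its right). -/
def FoxSeparates (m n : ℕ) (A B : List (ℝ × ℝ)) (c : ℝ) : Prop :=
  (∀ b ∈ B.take m, ∀ l : ℕ, (-b.1 - l) / b.2 < c) ∧
    (∀ a ∈ A.take n, ∀ k : ℕ, c < (1 - a.1 + k) / a.2)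

/-- The Mellin-Barnes integral `(1 / (2πi)) ∫ H(s) z^{-s} ds` along the upward vertical line
`s = c + i y`, `y ∈ ℝ`. -/
def mellinBarnes (m n : ℕ) (A B : List (ℝ × ℝ)) (c z : ℝ) : ℂ :=
  (1 / (2 * (Real.pi : ℂ))) *
    ∫ y : ℝ, foxSymbol m n A B ((c : ℂ) + (y : ℂ) * Complex.I) *
      (z : ℂ) ^ (-((c : ℂ) + (y : ℂ) * Complex.I))

open Classical in
/-- The Fox H-function `H^{m,n}_{p,q}(z)`, `z > 0`, with real parameters, in the case that a
vertical line separates the two families of poles and `a* > 0`: the Mellin-Barnes integral then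
converges absolutely and, by Cauchy's theorem, does not depend on the separating line. -/
def foxH (m n : ℕ) (A B : List (ℝ × ℝ)) (z : ℝ) : ℂ :=
  if h : ∃ c, FoxSeparates m n A B c then mellinBarnes m n A B h.choose z else 0

/-- The Fox H-function that occurs in the Green function is `H^{2,1}_{2,3}` with upper parameters
`(1, 1), (β + γ, β)` and lower parameters `(d/2, α/2), (1, 1), (1, α/2)`; its `a*` is
`2 - β`. -/
def greenH (α β γ : ℝ) (d : ℕ) (z : ℝ) : ℂ :=
  foxH 2 1 [(1, 1), (β + γ, β)] [((d : ℝ) / 2, α / 2), (1, 1), (1, α / 2)] z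

/-- The Green function `Y(t, x) = π^{-d/2} |x|^{-d} t^{β+γ-1} H(|x|^α / (2^{α-1} ν t^β))`.
The Fox H-function is real here (`greenH_im`), so the real part only changes the type. -/
def greenY (α β γ ν : ℝ) (d : ℕ) (t : ℝ) (x : EuclideanSpace ℝ (Fin d)) : ℝ :=
  Real.pi ^ (-(d : ℝ) / 2) * ‖x‖ ^ (-(d : ℝ)) * t ^ (β + γ - 1) *
    (greenH α β γ d (‖x‖ ^ α / (2 ^ (α - 1) * ν * t ^ β))).re

/-- The separating lines for the Green function are those with `-min(1, d/α) < c < 0`. -/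
theorem foxSeparates_green {α β γ : ℝ} {d : ℕ} (hα : 0 < α) (c : ℝ) :
    FoxSeparates 2 1 [(1, 1), (β + γ, β)] [((d : ℝ) / 2, α / 2), (1, 1), (1, α / 2)] c ↔
      -min 1 ((d : ℝ) / α) < c ∧ c < 0 := by
  have key : ∀ l : ℕ, (-((d : ℝ) / 2) - l) / (α / 2) = -((d : ℝ) / α) - 2 * l / α := by
    intro l; field_simp
  constructor
  · rintro ⟨h1, h2⟩
    have ha := h1 ((d : ℝ) / 2, α / 2) (by simp) 0
    have hb := h1 (1, 1) (by simp) 0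
    have hc := h2 (1, 1) (by simp) 0
    simp only [key] at ha
    norm_num at ha hb hc
    refine ⟨?_, hc⟩
    rcases min_choice 1 ((d : ℝ) / α) with h | h <;> rw [h] <;> linarith
  · rintro ⟨h1, h2⟩
    have h3 := min_le_left 1 ((d : ℝ) / α)
    have h4 := min_le_right 1 ((d : ℝ) / α)
    refine ⟨?_, ?_⟩
    · intro b hb l
      have hl : (0 : ℝ) ≤ l := Nat.cast_nonneg l
      simp only [List.take_succ_cons, List.take_zero, List.mem_cons, List.not_mem_nil,
        or_false] at hb
      rcases hb with rfl | rfl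
      · simp only [key]
        have : 0 ≤ 2 * (l : ℝ) / α := by positivity
        linarith
      · simp only [div_one]; linarith
    · intro a ha k
      have hk : (0 : ℝ) ≤ k := Nat.cast_nonneg k
      simp only [List.take_succ_cons, List.take_zero, List.mem_cons, List.not_mem_nil,
        or_false] at ha
      subst ha
      simp only [div_one]; linarith

theorem foxSymbol_conj (m n : ℕ) (A B : List (ℝ × ℝ)) (s : ℂ) :
    foxSymbol m n A B ((starRingEnd ℂ) s) = (starRingEnd ℂ) (foxSymbol m n A B s) := by
  simp only [foxSymbol, map_div₀, map_mul, map_list_prod, List.map_map, Function.comp_def,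
    ← Complex.Gamma_conj, map_add, map_sub, map_one, Complex.conj_ofReal]

/-- For real parameters and `z ≥ 0` the Mellin-Barnes integral is real. -/
theorem mellinBarnes_im (m n : ℕ) (A B : List (ℝ × ℝ)) (c z : ℝ) (hz : 0 ≤ z) :
    (mellinBarnes m n A B c z).im = 0 := by
  have harg : (z : ℂ).arg ≠ Real.pi := by
    rw [Complex.arg_ofReal_of_nonneg hz]; exact Real.pi_ne_zero.symm
  rw [← Complex.conj_eq_iff_im, mellinBarnes, map_mul, ← integral_conj,
    ← integral_neg_eq_self]
  congr 1
  · simp [Complex.conj_ofNat]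
  · congr 1
    funext y
    have hs : (c : ℂ) + ((-y : ℝ) : ℂ) * Complex.I
        = (starRingEnd ℂ) ((c : ℂ) + (y : ℂ) * Complex.I) := by
      simp
    rw [hs, map_mul, foxSymbol_conj, Complex.conj_conj, ← map_neg, Complex.cpow_conj _ _ harg,
      Complex.conj_conj, Complex.conj_ofReal]

theorem greenH_im (α β γ : ℝ) (d : ℕ) (z : ℝ) (hz : 0 ≤ z) : (greenH α β γ d z).im = 0 := by
  unfold greenH foxH
  split_ifs with h
  · exact mellinBarnes_im _ _ _ _ _ _ hz
  · simp

end

/-! Self-similarity splits the double integral into a product. The substitution `y = s^(β/α) x`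
turns the spatial integral at time `s` into `s^(2(β+γ-1) - βd/α) · A`, where `A` is the squared L²
norm of the profile `Y(1, ·)` (`lintegral_greenY_sq`). Since `A ≠ 0`, finiteness means that the
power of `s` is integrable at `0` and that `A < ∞`. The first condition reads `d < 2α +
(α/β)(2γ-1)`. The second turns out to be `d < 2α`, and the minimum in (i) combines the two.

In polar coordinates `A` is a constant times `∫ r^(-d-1) |H(r^α/K)|² dr` with `K = 2^(α-1) ν`.
Integration along `Re s = c` gives `|H(z)| ≤ C z^(-c)` for every `c` in `(-min(1, d/α), 0)`. If `d <
2α`, the critical value `c = -d/(2α)` lies inside this interval, and one line on each side of it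
yields convergence at `0` and at `∞`. If `d ≥ 2α`, then `α < d` and the first pole to the left of
the contour is the simple pole `-1` with nonzero residue. Hence `|H(z)| ≥ m z` near `0`
(`greenH_asymptotics`, `greenH_lower_bound`), and `r^(2α-d-1)` is not integrable at `0`.

The contour arguments rest on exponential decay of the symbol on vertical strips
(`GreenStrip.stripBound`): the Gamma factors contribute the total rate `-(π/2)(2-β) < 0`. -/

open Set Filter Topology

noncomputable section

/-! ### Exponential bounds on vertical strips -/

/-- `f` is `O(exp (κ |Im s|))` on the closed vertical strip `a ≤ Re s ≤ b`. -/
def StripBound (f : ℂ → ℂ) (a b κ : ℝ) : Prop :=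
  ∃ C : ℝ, 0 ≤ C ∧ ∀ x ∈ Icc a b, ∀ y : ℝ, ‖f (x + y * Complex.I)‖ ≤ C * Real.exp (κ * |y|)

namespace StripBound

variable {f g : ℂ → ℂ} {a b κ κ' : ℝ}

theorem mul (hf : StripBound f a b κ) (hg : StripBound g a b κ') :
    StripBound (fun s => f s * g s) a b (κ + κ') := by
  obtain ⟨C, hC, h⟩ := hf
  obtain ⟨D, hD, k⟩ := hg
  refine ⟨C * D, by positivity, fun x hx y => ?_⟩
  rw [norm_mul, add_mul, Real.exp_add, mul_mul_mul_comm]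
  exact mul_le_mul (h x hx y) (k x hx y) (norm_nonneg _) (by positivity)

theorem mono_exponent (hf : StripBound f a b κ) (hκ : κ ≤ κ') : StripBound f a b κ' := by
  obtain ⟨C, hC, h⟩ := hf
  refine ⟨C, hC, fun x hx y => (h x hx y).trans ?_⟩
  gcongr

theorem sub (hf : StripBound f a b κ) (hg : StripBound g a b κ) :
    StripBound (fun s => f s - g s) a b κ := by
  obtain ⟨C, hC, h⟩ := hf
  obtain ⟨D, hD, k⟩ := hg
  refine ⟨C + D, by positivity, fun x hx y => (norm_sub_le _ _).trans ?_⟩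
  rw [add_mul]
  exact add_le_add (h x hx y) (k x hx y)

theorem const_mul (hf : StripBound f a b κ) (c : ℂ) : StripBound (fun s => c * f s) a b κ := by
  obtain ⟨C, hC, h⟩ := hf
  refine ⟨‖c‖ * C, by positivity, fun x hx y => ?_⟩
  rw [norm_mul, mul_assoc]
  exact mul_le_mul_of_nonneg_left (h x hx y) (norm_nonneg _)

theorem comp_affine {p q a' b' : ℝ} (hf : StripBound f a b κ)
    (h : ∀ x ∈ Icc a' b', p + q * x ∈ Icc a b) :
    StripBound (fun s => f (p + q * s)) a' b' (|q| * κ) := by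
  obtain ⟨C, hC, hf⟩ := hf
  refine ⟨C, hC, fun x hx y => ?_⟩
  have := hf _ (h x hx) (q * y)
  rw [abs_mul, show κ * (|q| * |y|) = |q| * κ * |y| by ring] at this
  refine (congrArg (fun s => ‖f s‖) ?_).trans_le this
  push_cast
  ring

end StripBound

/-- Polynomial factors cost an arbitrarily small exponent. The recurrence for Gamma may thus be used
freely, at the price of the `ε` in the bounds below. -/
theorem stripBound_id (a b : ℝ) {ε : ℝ} (hε : 0 < ε) : StripBound (fun s => s) a b ε := by
  refine ⟨max |a| |b| + 1 / ε, by positivity, fun x hx y => ?_⟩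
  have h1 : ‖(x : ℂ) + y * Complex.I‖ ≤ |x| + |y| := by
    simpa using norm_add_le (x : ℂ) (y * Complex.I)
  have h2 : |x| ≤ max |a| |b| := abs_le_max_abs_abs hx.1 hx.2
  have h3 : ε * |y| + 1 ≤ Real.exp (ε * |y|) := Real.add_one_le_exp _
  have h4 : 1 ≤ Real.exp (ε * |y|) := Real.one_le_exp (by positivity)
  have h5 : |y| ≤ 1 / ε * Real.exp (ε * |y|) := by
    rw [one_div, inv_mul_eq_div, le_div_iff₀ hε]; linarith
  have h6 : max |a| |b| ≤ max |a| |b| * Real.exp (ε * |y|) :=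
    le_mul_of_one_le_right (by positivity) h4
  linarith

/-! ### Upper and lower bounds for Gamma on strips -/

/-- Moving to the right along a horizontal line increases `|Γ|` at least as much as on the real
axis. -/
theorem norm_Gamma_le_of_lt {x M : ℝ} (hx : 0 < x) (hM : x < M) (v : ℝ) :
    ‖Complex.Gamma (x + v * Complex.I)‖ ≤
      Real.Gamma x / Real.Gamma M * ‖Complex.Gamma (M + v * Complex.I)‖ := by
  have hMx : 0 < M - x := sub_pos.2 hM
  have hG := Real.Gamma_pos_of_pos hMx
  have hGM := Real.Gamma_pos_of_pos (hx.trans hM)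
  have hre : 0 < ((M : ℂ) - x).re := by simpa using hM
  -- Both Gamma values are linked by `Γ(x+iv) Γ(M-x) = Γ(M+iv) B(x+iv, M-x)`, and `|B(x+iv, M-x)| ≤
  -- B(x, M-x)` because `|t^(iv)| = 1`.
  have key := Complex.Gamma_mul_Gamma_eq_betaIntegral (s := x + v * Complex.I) (t := (M : ℂ) - x)
    (by simpa using hx) hre
  have key2 := Complex.Gamma_mul_Gamma_eq_betaIntegral (s := x) (t := (M : ℂ) - x)
    (by simpa using hx) hre
  have hn : ∀ u : ℝ, ∀ t ∈ Ioo (0 : ℝ) 1,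
      ‖(t : ℂ) ^ ((x : ℂ) + u * Complex.I - 1) * (1 - (t : ℂ)) ^ ((M : ℂ) - x - 1)‖
        = t ^ (x - 1) * (1 - t) ^ (M - x - 1) := by
    intro u t ht
    rw [norm_mul, Complex.norm_cpow_eq_rpow_re_of_pos ht.1, ← Complex.ofReal_one,
      ← Complex.ofReal_sub, Complex.norm_cpow_eq_rpow_re_of_pos (sub_pos.2 ht.2)]
    simp
  have hB : Complex.betaIntegral x ((M : ℂ) - x) =
      ((∫ t in (0 : ℝ)..1, t ^ (x - 1) * (1 - t) ^ (M - x - 1) : ℝ) : ℂ) := by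
    rw [Complex.betaIntegral, ← intervalIntegral.integral_ofReal]
    refine intervalIntegral.integral_congr fun t ht => ?_
    rw [uIcc_of_le zero_le_one] at ht
    simp only [Complex.ofReal_mul, Complex.ofReal_cpow ht.1, Complex.ofReal_cpow (sub_nonneg.2 ht.2)]
    push_cast
    rfl
  have hI : ‖Complex.betaIntegral (x + v * Complex.I) ((M : ℂ) - x)‖ ≤
      ∫ t in (0 : ℝ)..1, t ^ (x - 1) * (1 - t) ^ (M - x - 1) := by
    refine (intervalIntegral.norm_integral_le_integral_norm zero_le_one).trans_eq ?_
    rw [intervalIntegral.integral_of_le zero_le_one, intervalIntegral.integral_of_le zero_le_one,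
      integral_Ioc_eq_integral_Ioo, integral_Ioc_eq_integral_Ioo]
    exact setIntegral_congr_fun measurableSet_Ioo fun t ht => hn v t ht
  set B := ∫ t in (0 : ℝ)..1, t ^ (x - 1) * (1 - t) ^ (M - x - 1)
  have e1 : Real.Gamma x * Real.Gamma (M - x) = Real.Gamma M * B := by
    rw [hB, add_sub_cancel, ← Complex.ofReal_sub, Complex.Gamma_ofReal, Complex.Gamma_ofReal,
      Complex.Gamma_ofReal] at key2
    exact_mod_cast key2
  have e2 : ‖Complex.Gamma (x + v * Complex.I)‖ * Real.Gamma (M - x) ≤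
      ‖Complex.Gamma (M + v * Complex.I)‖ * B := by
    have := congrArg norm key
    rw [norm_mul, norm_mul, ← Complex.ofReal_sub, Complex.Gamma_ofReal, Complex.norm_real,
      Real.norm_of_nonneg hG.le] at this
    rw [this, show (x : ℂ) + v * Complex.I + ((M - x : ℝ) : ℂ) = M + v * Complex.I by
      push_cast; ring, Complex.ofReal_sub]
    gcongr
  have e3 : B = Real.Gamma x * Real.Gamma (M - x) / Real.Gamma M := by
    rw [e1]; field_simp
  rw [e3] at e2
  refine le_of_mul_le_mul_right (e2.trans_eq ?_) hG
  ring

/-- On the line `Re s = 1/2` one has `1 - s = conj s`, so the reflection formula computes `|Γ|²`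
exactly. All other bounds are transported from this line. -/
theorem norm_Gamma_half_sq (v : ℝ) :
    ‖Complex.Gamma ((1 / 2 : ℝ) + v * Complex.I)‖ ^ 2 = Real.pi / Real.cosh (Real.pi * v) := by
  have h := Complex.Gamma_mul_Gamma_one_sub ((1 / 2 : ℝ) + v * Complex.I)
  have h1 : 1 - (((1 / 2 : ℝ) : ℂ) + v * Complex.I) =
      (starRingEnd ℂ) ((1 / 2 : ℝ) + v * Complex.I) := by
    simp only [map_add, map_mul, Complex.conj_ofReal, Complex.conj_I]
    push_cast
    ring
  have h2 : Complex.sin (Real.pi * ((1 / 2 : ℝ) + v * Complex.I)) =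
      (Real.cosh (Real.pi * v) : ℝ) := by
    rw [show (Real.pi : ℂ) * ((1 / 2 : ℝ) + v * Complex.I) =
      (Real.pi * v : ℝ) * Complex.I + Real.pi / 2 by push_cast; ring, Complex.sin_add_pi_div_two,
      Complex.cos_mul_I, Complex.ofReal_cosh]
  rw [h1, Complex.Gamma_conj, Complex.mul_conj, h2, Complex.normSq_eq_norm_sq] at h
  exact_mod_cast h

theorem norm_Gamma_half_le (v : ℝ) : ‖Complex.Gamma ((1 / 2 : ℝ) + v * Complex.I)‖ ≤
    √(2 * Real.pi) * Real.exp (-(Real.pi / 2) * |v|) := by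
  refine le_of_sq_le_sq ?_ (by positivity)
  rw [norm_Gamma_half_sq, mul_pow, Real.sq_sqrt (by positivity), ← Real.exp_nat_mul,
    ← Real.cosh_abs, abs_mul, abs_of_pos Real.pi_pos,
    show ((2 : ℕ) : ℝ) * (-(Real.pi / 2) * |v|) = -(Real.pi * |v|) by push_cast; ring,
    div_le_iff₀ (Real.cosh_pos _), Real.exp_neg, Real.cosh_eq]
  have := Real.exp_pos (Real.pi * |v|)
  have := Real.exp_pos (-(Real.pi * |v|))
  have hp := Real.pi_pos
  have : 2 * Real.pi * (Real.exp (Real.pi * |v|))⁻¹ *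
      ((Real.exp (Real.pi * |v|) + Real.exp (-(Real.pi * |v|))) / 2) =
      Real.pi + Real.pi * ((Real.exp (Real.pi * |v|))⁻¹ * Real.exp (-(Real.pi * |v|))) := by
    field_simp
  rw [this]
  have : 0 ≤ Real.pi * ((Real.exp (Real.pi * |v|))⁻¹ * Real.exp (-(Real.pi * |v|))) := by positivity
  linarith

theorem norm_Gamma_half_inv_le (v : ℝ) : ‖Complex.Gamma ((1 / 2 : ℝ) + v * Complex.I)‖⁻¹ ≤
    Real.exp (Real.pi / 2 * |v|) := by
  refine le_of_sq_le_sq ?_ (by positivity)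
  rw [inv_pow, norm_Gamma_half_sq, ← Real.exp_nat_mul, ← Real.cosh_abs, abs_mul,
    abs_of_pos Real.pi_pos, show ((2 : ℕ) : ℝ) * (Real.pi / 2 * |v|) = Real.pi * |v| by
      push_cast; ring, inv_div, div_le_iff₀ Real.pi_pos, Real.cosh_eq]
  have h1 : Real.exp (-(Real.pi * |v|)) ≤ Real.exp (Real.pi * |v|) :=
    Real.exp_le_exp.2 (by have := Real.pi_pos; have := abs_nonneg v; nlinarith)
  have := Real.exp_pos (Real.pi * |v|)
  nlinarith [Real.pi_gt_three]

theorem stripBound_Gamma_half (m : ℕ) {ε : ℝ} (hε : 0 < ε) :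
    StripBound Complex.Gamma (m + 1 / 2) (m + 1 / 2) (-(Real.pi / 2) + ε) := by
  induction m generalizing ε with
  | zero =>
    refine StripBound.mono_exponent (κ := -(Real.pi / 2)) ?_ (by linarith)
    refine ⟨√(2 * Real.pi), by positivity, fun x hx y => ?_⟩
    have : x = 1 / 2 := by
      have h1 := hx.1; have h2 := hx.2
      simp only [Nat.cast_zero, zero_add] at h1 h2
      linarith
    rw [this]
    exact norm_Gamma_half_le y
  | succ m ih =>
    have h := (stripBound_id (m + 1 / 2) (m + 1 / 2) (half_pos hε)).mul (ih (half_pos hε))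
    rw [show ε / 2 + (-(Real.pi / 2) + ε / 2) = -(Real.pi / 2) + ε by ring] at h
    obtain ⟨C, hC, h⟩ := h
    refine ⟨C, hC, fun x hx y => ?_⟩
    have hx' : x - 1 = m + 1 / 2 := by
      have h1 := hx.1; have h2 := hx.2; push_cast at h1 h2; linarith
    have h1 := h (x - 1) ⟨hx'.ge, hx'.le⟩ y
    beta_reduce at h1
    rw [← Complex.Gamma_add_one] at h1
    · convert h1 using 3; push_cast; ring
    · intro h0
      have := congrArg Complex.re h0
      simp at this
      have : (0 : ℝ) ≤ m := m.cast_nonneg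
      linarith

theorem continuousOn_Gamma_Icc {a b : ℝ} (ha : 0 < a) : ContinuousOn Real.Gamma (Icc a b) :=
  fun x hx => (Real.differentiableAt_Gamma fun m h => by
    have : (0 : ℝ) ≤ m := m.cast_nonneg
    have := hx.1
    linarith).continuousAt.continuousWithinAt

/-- Comparison with a line `Re s = m + 1/2` to the right of the strip, where the bound comes from
the line `1/2` by the recurrence. -/
theorem stripBound_Gamma {a b : ℝ} (ha : 0 < a) {ε : ℝ} (hε : 0 < ε) :
    StripBound Complex.Gamma a b (-(Real.pi / 2) + ε) := by
  obtain ⟨m, hm⟩ := exists_nat_gt b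
  obtain ⟨C, hC, h⟩ := stripBound_Gamma_half m hε
  obtain ⟨D, hD⟩ := isCompact_Icc.exists_bound_of_continuousOn (continuousOn_Gamma_Icc (b := b) ha)
  have hM : (0 : ℝ) < m + 1 / 2 := by positivity
  have hG := Real.Gamma_pos_of_pos hM
  refine ⟨|D| / Real.Gamma (m + 1 / 2) * C, by positivity, fun x hx y => ?_⟩
  have hx0 : 0 < x := ha.trans_le hx.1
  refine (norm_Gamma_le_of_lt hx0 (M := m + 1 / 2) (by linarith [hx.2]) y).trans ?_
  rw [mul_assoc]
  have h1 : Real.Gamma x ≤ |D| := (le_abs_self _).trans ((hD x hx).trans (le_abs_self _))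
  have h2 := h (m + 1 / 2) ⟨le_rfl, le_rfl⟩ y
  exact mul_le_mul (by gcongr) h2 (norm_nonneg _) (by positivity)

/-- A lower bound for `|Γ|` comes from comparison with the line `1/2` to the left. The strip may
begin left of `1/2`, so `Γ(s+1) = s Γ(s)` is compared instead, and the factor `s` is absorbed in
`ε`. -/
theorem stripBound_inv_Gamma {a b : ℝ} (ha : 0 < a) {ε : ℝ} (hε : 0 < ε) :
    StripBound (fun s => (Complex.Gamma s)⁻¹) a b (Real.pi / 2 + ε) := by
  obtain ⟨C, hC, h⟩ := stripBound_id a b hε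
  have hcont : ContinuousOn (fun x => Real.Gamma (1 / 2) / Real.Gamma (x + 1)) (Icc a b) :=
    continuousOn_const.div
      ((continuousOn_Gamma_Icc (a := a + 1) (b := b + 1) (by linarith)).comp (by fun_prop)
        fun x hx => ⟨by linarith [hx.1], by linarith [hx.2]⟩)
      fun x hx => (Real.Gamma_pos_of_pos (by linarith [hx.1])).ne'
  obtain ⟨D, hD⟩ := isCompact_Icc.exists_bound_of_continuousOn hcont
  refine ⟨C * |D|, by positivity, fun x hx y => ?_⟩
  have hx0 : 0 < x := ha.trans_le hx.1
  have hs0 : (x : ℂ) + y * Complex.I ≠ 0 := fun h0 => by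
    have := congrArg Complex.re h0
    simp at this
    linarith
  have hG0 : Complex.Gamma (x + y * Complex.I) ≠ 0 :=
    Complex.Gamma_ne_zero_of_re_pos (by simpa using hx0)
  have hG1 : Complex.Gamma ((1 / 2 : ℝ) + y * Complex.I) ≠ 0 :=
    Complex.Gamma_ne_zero_of_re_pos (by simp)
  have h1 := norm_Gamma_le_of_lt (x := 1 / 2) (M := x + 1) (by norm_num) (by linarith) y
  have h2 : Real.Gamma (1 / 2) / Real.Gamma (x + 1) ≤ |D| :=
    (le_abs_self _).trans ((hD x hx).trans (le_abs_self _))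
  have h3 : ‖Complex.Gamma (((x + 1 : ℝ) : ℂ) + y * Complex.I)‖ =
      ‖(x : ℂ) + y * Complex.I‖ * ‖Complex.Gamma (x + y * Complex.I)‖ := by
    rw [← norm_mul, ← Complex.Gamma_add_one _ hs0]; congr 2; push_cast; ring
  rw [h3] at h1
  have hN := norm_pos_iff.2 hG0
  have hN1 := norm_pos_iff.2 hG1
  rw [norm_inv]
  have h4 : ‖Complex.Gamma (x + y * Complex.I)‖⁻¹ ≤
      (|D| * ‖(x : ℂ) + y * Complex.I‖) * ‖Complex.Gamma ((1 / 2 : ℝ) + y * Complex.I)‖⁻¹ := by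
    rw [← div_eq_mul_inv, inv_eq_one_div, div_le_div_iff₀ hN hN1, one_mul]
    refine h1.trans ?_
    rw [mul_assoc]
    gcongr
  refine h4.trans ?_
  calc _ ≤ |D| * (C * Real.exp (ε * |y|)) * Real.exp (Real.pi / 2 * |y|) :=
        mul_le_mul (mul_le_mul_of_nonneg_left (h x hx y) (abs_nonneg _))
          (norm_Gamma_half_inv_le y) (by positivity) (by positivity)
    _ = _ := by rw [add_mul, Real.exp_add]; ring

/-! ### Vertical integrals, contour shifts and the inverse Mellin transform -/

theorem integrable_exp_mul_abs {κ : ℝ} (hκ : κ < 0) :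
    Integrable fun y : ℝ => Real.exp (κ * |y|) := by
  have h1 : IntegrableOn (fun y : ℝ => Real.exp (κ * |y|)) (Ioi 0) :=
    (integrableOn_exp_mul_Ioi hκ 0).congr_fun
      (fun y hy => by simp only [abs_of_pos (mem_Ioi.1 hy)]) measurableSet_Ioi
  have h2 : IntegrableOn (fun y : ℝ => Real.exp (κ * |y|)) (Iic 0) :=
    (integrableOn_exp_mul_Iic (neg_pos.2 hκ) 0).congr_fun
      (fun y hy => by simp only [abs_of_nonpos (mem_Iic.1 hy)]; ring_nf) measurableSet_Iic
  rw [← integrableOn_univ, ← Iic_union_Ioi (a := (0 : ℝ))]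
  exact h2.union h1

theorem continuous_vertical {f : ℂ → ℂ} {a b x : ℝ}
    (hf : DifferentiableOn ℂ f {s | a ≤ s.re ∧ s.re ≤ b}) (hx : x ∈ Icc a b) :
    Continuous fun y : ℝ => f (x + y * Complex.I) := by
  rw [← continuousOn_univ]
  exact hf.continuousOn.comp (by fun_prop) fun y _ => by simpa using hx

theorem stripBound_cpow_neg (a b : ℝ) {z : ℝ} (hz : 0 < z) :
    StripBound (fun s => (z : ℂ) ^ (-s)) a b 0 := by
  obtain ⟨D, hD⟩ := isCompact_Icc.exists_bound_of_continuousOn (s := Icc a b)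
    (f := fun x : ℝ => z ^ (-x))
    ((Real.continuous_const_rpow hz.ne').comp continuous_neg).continuousOn
  refine ⟨|D|, abs_nonneg _, fun x hx y => ?_⟩
  rw [Complex.norm_cpow_eq_rpow_re_of_pos hz]
  simpa using (le_abs_self _).trans ((hD x hx).trans (le_abs_self _))

theorem differentiable_cpow_neg {z : ℝ} (hz : 0 < z) :
    Differentiable ℂ fun s : ℂ => (z : ℂ) ^ (-s) := fun s =>
  (differentiable_neg s).const_cpow (Or.inl (Complex.ofReal_ne_zero.2 hz.ne'))

namespace StripBound

variable {f : ℂ → ℂ} {a b κ : ℝ}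

theorem verticalIntegrable (h : StripBound f a b κ) (hκ : κ < 0)
    (hf : DifferentiableOn ℂ f {s | a ≤ s.re ∧ s.re ≤ b}) {x : ℝ} (hx : x ∈ Icc a b) :
    Complex.VerticalIntegrable f x := by
  obtain ⟨C, -, h⟩ := h
  exact ((integrable_exp_mul_abs hκ).const_mul C).mono'
    (continuous_vertical hf hx).aestronglyMeasurable (Eventually.of_forall (h x hx))

/-- The integral of an exponentially decaying holomorphic function along a vertical line does not
depend on the line. -/
theorem integral_eq (h : StripBound f a b κ) (hκ : κ < 0) (hab : a ≤ b)
    (hf : DifferentiableOn ℂ f {s | a ≤ s.re ∧ s.re ≤ b}) :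
    ∫ y : ℝ, f (a + y * Complex.I) = ∫ y : ℝ, f (b + y * Complex.I) := by
  have ia := h.verticalIntegrable hκ hf (left_mem_Icc.2 hab)
  have ib := h.verticalIntegrable hκ hf (right_mem_Icc.2 hab)
  obtain ⟨C, hC, h⟩ := h
  -- Cauchy's theorem on the rectangle `[a, b] × [-T, T]`: the horizontal sides are `O(exp (κ T))`
  -- and vanish as `T → ∞`.
  have ta := intervalIntegral_tendsto_integral ia tendsto_neg_atTop_atBot tendsto_id
  have tb := intervalIntegral_tendsto_integral ib tendsto_neg_atTop_atBot tendsto_id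
  have hexp : Tendsto (fun T : ℝ => C * Real.exp (κ * |T|) * |b - a|) atTop (𝓝 0) := by
    have h0 : Tendsto (fun T : ℝ => κ * |T|) atTop atBot :=
      tendsto_abs_atTop_atTop.const_mul_atTop_of_neg hκ
    simpa using ((Real.tendsto_exp_atBot.comp h0).const_mul C).mul_const |b - a|
  have hor : ∀ T : ℝ, ‖∫ x in a..b, f (x + T * Complex.I)‖ ≤ C * Real.exp (κ * |T|) * |b - a| :=
    fun T => intervalIntegral.norm_integral_le_of_norm_le_const fun x hx => by
      rw [uIoc_of_le hab] at hx
      exact h x ⟨hx.1.le, hx.2⟩ T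
  have t1 : Tendsto (fun T : ℝ => ∫ x in a..b, f (x + T * Complex.I)) atTop (𝓝 0) :=
    squeeze_zero_norm hor hexp
  have t2 : Tendsto (fun T : ℝ => ∫ x in a..b, f (x + (-T : ℝ) * Complex.I)) atTop (𝓝 0) :=
    squeeze_zero_norm (fun T => by simpa only [abs_neg] using hor (-T)) hexp
  have key := ((t2.sub t1).add (tb.const_smul Complex.I)).sub (ta.const_smul Complex.I)
  have zero : ∀ T : ℝ, (∫ x in a..b, f (x + (-T : ℝ) * Complex.I)) -
      (∫ x in a..b, f (x + T * Complex.I)) +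
      Complex.I • (∫ y in -T..id T, f (b + y * Complex.I)) -
      Complex.I • (∫ y in -T..id T, f (a + y * Complex.I)) = 0 := fun T => by
    have := Complex.integral_boundary_rect_eq_zero_of_differentiableOn f ⟨a, -T⟩ ⟨b, T⟩
      (hf.mono fun s hs => by
        have := hs.1
        simpa [uIcc_of_le hab] using this)
    simpa using this
  simp only [zero] at key
  have h0 := tendsto_nhds_unique key tendsto_const_nhds
  rw [sub_zero, zero_add, ← smul_sub, smul_eq_mul, mul_eq_zero] at h0
  exact (sub_eq_zero.1 (h0.resolve_left Complex.I_ne_zero)).symm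

theorem mellinInv_eq (h : StripBound f a b κ) (hκ : κ < 0) (hab : a ≤ b)
    (hf : DifferentiableOn ℂ f {s | a ≤ s.re ∧ s.re ≤ b}) {z : ℝ} (hz : 0 < z) :
    mellinInv a f z = mellinInv b f z := by
  have := ((stripBound_cpow_neg a b hz).mul h).integral_eq (by simpa using hκ) hab
    ((differentiable_cpow_neg hz).differentiableOn.mul hf)
  simp only [mellinInv, smul_eq_mul, this]

theorem integrable_cpow_smul (h : StripBound f a b κ) (hκ : κ < 0)
    (hf : DifferentiableOn ℂ f {s | a ≤ s.re ∧ s.re ≤ b}) {x : ℝ} (hx : x ∈ Icc a b) {z : ℝ}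
    (hz : 0 < z) :
    Integrable fun y : ℝ =>
      (z : ℂ) ^ (-((x : ℂ) + y * Complex.I)) • f (x + y * Complex.I) :=
  ((stripBound_cpow_neg a b hz).mul h).verticalIntegrable (by simpa using hκ)
    ((differentiable_cpow_neg hz).differentiableOn.mul hf) hx

/-- On the line `Re s = x` the kernel has constant modulus `z^(-x)`, so the position of the line
dictates the power of `z`. -/
theorem norm_mellinInv_le (h : StripBound f a b κ) (hκ : κ < 0) {x : ℝ} (hx : x ∈ Icc a b) :
    ∃ C, 0 < C ∧ ∀ z : ℝ, 0 < z → ‖mellinInv x f z‖ ≤ C * z ^ (-x) := by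
  obtain ⟨C, hC, h⟩ := h
  refine ⟨1 / (2 * Real.pi) * (∫ y : ℝ, C * Real.exp (κ * |y|)) + 1,
    add_pos_of_nonneg_of_pos (mul_nonneg (by positivity) (integral_nonneg fun y => by positivity))
      one_pos, fun z hz => ?_⟩
  have h1 : ‖∫ y : ℝ, (z : ℂ) ^ (-((x : ℂ) + y * Complex.I)) • f (x + y * Complex.I)‖ ≤
      ∫ y : ℝ, z ^ (-x) * (C * Real.exp (κ * |y|)) := by
    refine norm_integral_le_of_norm_le (((integrable_exp_mul_abs hκ).const_mul C).const_mul _)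
      (Eventually.of_forall fun y => ?_)
    rw [norm_smul, Complex.norm_cpow_eq_rpow_re_of_pos hz]
    simpa using mul_le_mul_of_nonneg_left (h x hx y) (Real.rpow_nonneg hz.le (-x))
  rw [integral_const_mul] at h1
  have hz' := Real.rpow_pos_of_pos hz (-x)
  rw [mellinInv, norm_smul, norm_div, norm_one, norm_mul]
  simp only [RCLike.norm_ofNat, Real.norm_of_nonneg Real.pi_pos.le]
  rw [add_mul, one_mul, mul_assoc, mul_comm (∫ y : ℝ, C * Real.exp (κ * |y|))]
  have : 1 / (2 * Real.pi) * ‖∫ y : ℝ, (z : ℂ) ^ (-((x : ℂ) + y * Complex.I)) •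
      f (x + y * Complex.I)‖ ≤ 1 / (2 * Real.pi) * (z ^ (-x) * ∫ y : ℝ, C * Real.exp (κ * |y|)) := by
    gcongr
  linarith

end StripBound

theorem integrable_vertical_two_pi {f : ℂ → ℂ} {x : ℝ} (h : Complex.VerticalIntegrable f x) :
    Integrable fun y : ℝ => f (x + 2 * Real.pi * y * Complex.I) := by
  have := Integrable.comp_mul_left' h (mul_ne_zero two_ne_zero Real.pi_ne_zero)
  simpa using this

open scoped FourierTransform

theorem continuousOn_mellinInv {f : ℂ → ℂ} {x : ℝ} (h : Complex.VerticalIntegrable f x) :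
    ContinuousOn (mellinInv x f) (Ioi 0) := by
  have hc : Continuous (𝓕⁻ fun y : ℝ => f (x + 2 * Real.pi * y * Complex.I)) := by
    have : Continuous (𝓕 fun y : ℝ => f (x + 2 * Real.pi * y * Complex.I)) :=
      VectorFourier.fourierIntegral_continuous Real.continuous_fourierChar
        (by exact (innerSL ℝ (E := ℝ)).continuous₂) (integrable_vertical_two_pi h)
    have h2 : (𝓕⁻ fun y : ℝ => f (x + 2 * Real.pi * y * Complex.I)) =
      fun w => (𝓕 fun y : ℝ => f (x + 2 * Real.pi * y * Complex.I)) (-w) :=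
        funext fun w => Real.fourierInv_eq_fourier_neg _ _
    rw [h2]
    exact this.comp continuous_neg
  refine ContinuousOn.congr (f := fun z : ℝ => (z : ℂ) ^ (-x : ℂ) •
    (𝓕⁻ fun y : ℝ => f (x + 2 * Real.pi * y * Complex.I)) (-Real.log z)) ?_
    fun z hz => mellinInv_eq_fourierInv x f hz
  have hlog : ContinuousOn (fun z : ℝ => -Real.log z) (Ioi 0) :=
    (Real.continuousOn_log.mono fun z (hz : 0 < z) => hz.ne').neg
  have h1 : ContinuousOn (fun z : ℝ => (z : ℂ) ^ (-x : ℂ)) (Ioi 0) := fun z hz =>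
    (Complex.continuousAt_ofReal_cpow_const z _ (Or.inr (mem_Ioi.1 hz).ne')).continuousWithinAt
  exact h1.smul (hc.comp_continuousOn hlog)

/-- The inverse Mellin transform is injective. -/
theorem eq_zero_of_mellinInv_eq_zero {f : ℂ → ℂ} {x : ℝ} (h : Complex.VerticalIntegrable f x)
    (hc : Continuous fun y : ℝ => f (x + y * Complex.I))
    (h0 : ∀ z : ℝ, 0 < z → mellinInv x f z = 0) (y : ℝ) : f (x + y * Complex.I) = 0 := by
  -- With `z = exp(-w)` the inverse Mellin transform is an inverse Fourier transform times a
  -- nonvanishing factor, so Fourier inversion applies.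
  have hF : (𝓕⁻ fun y : ℝ => f (x + 2 * Real.pi * y * Complex.I)) = 0 := by
    funext w
    have := mellinInv_eq_fourierInv x f (Real.exp_pos (-w))
    rw [h0 _ (Real.exp_pos _), Real.log_exp, neg_neg, eq_comm, smul_eq_zero] at this
    refine this.resolve_left ?_
    rw [Complex.cpow_def_of_ne_zero (Complex.ofReal_ne_zero.2 (Real.exp_pos _).ne')]
    exact Complex.exp_ne_zero _
  have hc' : Continuous fun y : ℝ => f (x + 2 * Real.pi * y * Complex.I) := by
    have := hc.comp (continuous_const.mul continuous_id : Continuous fun y : ℝ => 2 * Real.pi * y)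
    simpa [Function.comp_def] using this
  have hz : 𝓕 (0 : ℝ → ℂ) = 0 := by
    funext w
    simp [Real.fourier_eq]
  have := hc'.fourier_fourierInv_eq (integrable_vertical_two_pi h) (by
    have h2 : (𝓕 fun y : ℝ => f (x + 2 * Real.pi * y * Complex.I)) = 0 := funext fun w => by
      rw [← neg_neg w, ← Real.fourierInv_eq_fourier_neg, hF, Pi.zero_apply, Pi.zero_apply]
    rw [h2]
    exact integrable_zero _ _ _)
  rw [hF, hz] at this
  have h1 := congrFun this (y / (2 * Real.pi))
  have hp : (Real.pi : ℂ) ≠ 0 := Complex.ofReal_ne_zero.2 Real.pi_ne_zero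
  rw [Pi.zero_apply] at h1
  rw [h1]
  congr 2
  push_cast
  field_simp

theorem mellin_exp_neg_mul {s : ℂ} (hs : 0 < s.re + 1) :
    MellinConvergent (fun z : ℝ => ((z * Real.exp (-z) : ℝ) : ℂ)) s ∧
      mellin (fun z : ℝ => ((z * Real.exp (-z) : ℝ) : ℂ)) s = Complex.Gamma (1 + s) := by
  have e : ∀ z ∈ Ioi (0 : ℝ), (z : ℂ) ^ (s - 1) • ((z * Real.exp (-z) : ℝ) : ℂ) =
      ((Real.exp (-z) : ℝ) : ℂ) * (z : ℂ) ^ (1 + s - 1) := fun z hz => by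
    have hz0 : (z : ℂ) ≠ 0 := Complex.ofReal_ne_zero.2 (mem_Ioi.1 hz).ne'
    rw [show 1 + s - 1 = s - 1 + 1 by ring, Complex.cpow_add _ _ hz0, Complex.cpow_one, smul_eq_mul]
    push_cast
    ring
  have hs' : 0 < (1 + s).re := by simpa [add_comm] using hs
  constructor
  · exact (Complex.GammaIntegral_convergent hs').congr_fun (fun z hz => (e z hz).symm)
      measurableSet_Ioi
  · rw [mellin, setIntegral_congr_fun measurableSet_Ioi e, Complex.Gamma_eq_integral hs',
      Complex.GammaIntegral]

theorem stripBound_Gamma_one_add {a b ε : ℝ} (ha : -1 < a) (hε : 0 < ε) :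
    StripBound (fun s => Complex.Gamma (1 + s)) a b (-(Real.pi / 2) + ε) := by
  have := (stripBound_Gamma (a := 1 + a) (b := 1 + b) (by linarith) hε).comp_affine
    (p := 1) (q := 1) (a' := a) (b' := b) fun x hx => ⟨by linarith [hx.1], by linarith [hx.2]⟩
  simpa using this

theorem differentiableOn_Gamma_comp {g : ℂ → ℂ} (hg : Differentiable ℂ g) {U : Set ℂ}
    (h : ∀ s ∈ U, 0 < (g s).re) : DifferentiableOn ℂ (fun s => Complex.Gamma (g s)) U :=
  fun s hs => ((Complex.differentiableAt_Gamma _ fun m hm => by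
    have := h s hs
    rw [hm] at this
    have h0 : (0 : ℝ) ≤ m := m.cast_nonneg
    simp at this
    linarith).comp s (hg s)).differentiableWithinAt

/-- `z exp(-z)` serves as an explicit comparison function: its Mellin transform decays exponentially
and has a simple pole at `-1`, which can cancel that of the Green symbol. -/
theorem mellinInv_Gamma_one_add {c z : ℝ} (hc : -1 < c) (hz : 0 < z) :
    mellinInv c (fun s => Complex.Gamma (1 + s)) z = ((z * Real.exp (-z) : ℝ) : ℂ) := by
  have hs : ∀ y : ℝ, 0 < ((c : ℂ) + y * Complex.I).re + 1 := fun y => by simp; linarith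
  have e : ∀ y : ℝ, mellin (fun z : ℝ => ((z * Real.exp (-z) : ℝ) : ℂ)) (c + y * Complex.I) =
      Complex.Gamma (1 + (c + y * Complex.I)) := fun y => (mellin_exp_neg_mul (hs y)).2
  rw [← mellinInv_mellin_eq c (fun z : ℝ => ((z * Real.exp (-z) : ℝ) : ℂ)) hz]
  · simp only [mellinInv, e]
  · exact (mellin_exp_neg_mul (by simpa using hs 0)).1
  · simp only [Complex.VerticalIntegrable, e]
    exact (stripBound_Gamma_one_add (a := c) (b := c) hc (ε := 1)
      one_pos).verticalIntegrable (by linarith [Real.pi_gt_three])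
      (differentiableOn_Gamma_comp (by fun_prop) fun s hs => by
        have := hs.1; simp; linarith) ⟨le_rfl, le_rfl⟩
  · fun_prop

/-- Removing a zero on the real axis preserves exponential bounds. -/
theorem StripBound.dslope {f : ℂ → ℂ} {a b κ p : ℝ} (h : StripBound f a b κ)
    (hd : ContinuousOn (dslope f p) {s | a ≤ s.re ∧ s.re ≤ b}) (hp : f p = 0) :
    StripBound (dslope f p) a b κ := by
  obtain ⟨C, hC, h⟩ := h
  obtain ⟨D, hD⟩ := ((isCompact_Icc (a := a) (b := b)).reProdIm
    (isCompact_Icc (a := (-1 : ℝ)) (b := 1))).exists_bound_of_continuousOn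
    (hd.mono fun s hs => hs.1)
  refine ⟨C + |D| * Real.exp |κ|, by positivity, fun x hx y => ?_⟩
  -- Near the real axis compactness bounds the quotient, and `exp |κ|` compensates a possibly
  -- negative `κ`. For `|y| ≥ 1` the divisor has modulus at least `1`.
  rcases le_total |y| 1 with hy | hy
  · have h1 : ‖_root_.dslope f p (x + y * Complex.I)‖ ≤ |D| :=
      (hD _ ⟨by simpa using hx, by simpa using abs_le.1 hy⟩).trans (le_abs_self _)
    have h2 : 1 ≤ Real.exp |κ| * Real.exp (κ * |y|) := by
      rw [← Real.exp_add, Real.one_le_exp_iff]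
      nlinarith [neg_abs_le κ, abs_nonneg κ, abs_nonneg y]
    have h3 : 0 ≤ C * Real.exp (κ * |y|) := by positivity
    have h4 := mul_le_mul_of_nonneg_left h2 (abs_nonneg D)
    linarith
  · have hne : (x : ℂ) + y * Complex.I ≠ p := fun h0 => by
      have := congrArg Complex.im h0
      simp at this
      rw [this] at hy
      norm_num at hy
    have h1 : 1 ≤ ‖(x : ℂ) + y * Complex.I - p‖ := by
      refine hy.trans ?_
      simpa using Complex.abs_im_le_norm ((x : ℂ) + y * Complex.I - p)
    rw [dslope_of_ne _ hne, slope_def_field, hp, sub_zero, norm_div]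
    refine (div_le_self (norm_nonneg _) h1).trans ((h x hx y).trans ?_)
    rw [add_mul]
    have : 0 ≤ |D| * Real.exp |κ| * Real.exp (κ * |y|) := by positivity
    linarith

/-! ### The Mellin symbol of the Green function -/

theorem mellinBarnes_eq_mellinInv (m n : ℕ) (A B : List (ℝ × ℝ)) (c z : ℝ) :
    mellinBarnes m n A B c z = mellinInv c (foxSymbol m n A B) z := by
  rw [mellinBarnes, mellinInv, Complex.real_smul]
  push_cast
  simp only [smul_eq_mul, mul_comm]

/-- The symbol of `greenH`, multiplied by `1 + s` to remove the pole at `s = -1`. -/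
def greenReg (α β γ : ℝ) (d : ℕ) (s : ℂ) : ℂ :=
  Complex.Gamma ((2 : ℝ) + (1 : ℝ) * s) * (Complex.Gamma ((0 : ℝ) + (-1 : ℝ) * s) *
    (Complex.Gamma (((d : ℝ) / 2 : ℝ) + (α / 2 : ℝ) * s) *
      ((Complex.Gamma ((β + γ : ℝ) + (β : ℝ) * s))⁻¹ *
        (Complex.Gamma ((0 : ℝ) + (-(α / 2) : ℝ) * s))⁻¹)))

/-- The symbol of `greenH`. -/
def greenSymbol (α β γ : ℝ) (d : ℕ) (s : ℂ) : ℂ := greenReg α β γ d s * (1 + s)⁻¹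

/-- Also valid at `s = -1`, where the conventions `Γ(0) = 0` and `0⁻¹ = 0` agree. -/
theorem Gamma_one_add (s : ℂ) :
    Complex.Gamma (1 + s) = Complex.Gamma ((2 : ℝ) + (1 : ℝ) * s) * (1 + s)⁻¹ := by
  rcases eq_or_ne (1 + s) 0 with h | h
  · rw [h, Complex.Gamma_zero, inv_zero, mul_zero]
  · have := Complex.Gamma_add_one (1 + s) h
    rw [show ((2 : ℝ) : ℂ) + (1 : ℝ) * s = 1 + s + 1 by push_cast; ring, this]
    field_simp

theorem foxSymbol_green (α β γ : ℝ) (d : ℕ) :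
    foxSymbol 2 1 [(1, 1), (β + γ, β)] [((d : ℝ) / 2, α / 2), (1, 1), (1, α / 2)] =
      greenSymbol α β γ d := by
  funext s
  simp only [foxSymbol, greenSymbol, greenReg, List.take_succ_cons, List.take_zero,
    List.drop_succ_cons, List.drop_zero, List.map_cons, List.map_nil, List.prod_cons,
    List.prod_nil, mul_one, Complex.ofReal_one, one_mul, Gamma_one_add]
  rw [div_eq_mul_inv, mul_inv]
  simp only [Complex.ofReal_zero, Complex.ofReal_neg, sub_self, zero_sub, zero_add,
    Complex.ofReal_one, one_mul, neg_mul]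
  ring

section

variable {α β γ a b : ℝ} {d : ℕ}

/-- The strip `a ≤ Re s ≤ b` contains no pole of `greenReg`. -/
structure GreenStrip (α β γ : ℝ) (d : ℕ) (a b : ℝ) : Prop where
  left : -2 < a
  right : b < 0
  dim : 0 < (d : ℝ) / 2 + α / 2 * a
  time : 0 < β + γ + β * a

theorem GreenStrip.differentiableOn (h : GreenStrip α β γ d a b) (hα : 0 < α) :
    DifferentiableOn ℂ (greenReg α β γ d) {s | a ≤ s.re ∧ s.re ≤ b} := by
  have hb := h.right
  have h1 := h.left
  have h2 := h.dim
  have inv : ∀ p q : ℝ, Differentiable ℂ fun s : ℂ => (Complex.Gamma (p + q * s))⁻¹ := fun p q =>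
    Complex.differentiable_one_div_Gamma.comp (by fun_prop : Differentiable ℂ fun s : ℂ => p + q * s)
  refine DifferentiableOn.mul (differentiableOn_Gamma_comp (by fun_prop) fun s hs => ?_) <|
    DifferentiableOn.mul (differentiableOn_Gamma_comp (by fun_prop) fun s hs => ?_) <|
    DifferentiableOn.mul (differentiableOn_Gamma_comp (by fun_prop) fun s hs => ?_) <|
    DifferentiableOn.mul (inv _ _).differentiableOn (inv _ _).differentiableOn
  · have := hs.1
    simp; linarith
  · have := hs.2
    simp; linarith
  · have := hs.1
    rw [Complex.add_re, Complex.ofReal_re, Complex.re_ofReal_mul]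
    nlinarith

theorem GreenStrip.stripBound (h : GreenStrip α β γ d a b) (hα : 0 < α) (hβ : 0 < β)
    (hβ2 : β < 2) : ∃ κ < 0, StripBound (greenReg α β γ d) a b κ := by
  have hb := h.right
  have h1 := h.left
  have h2 := h.dim
  have h3 := h.time
  -- The five factors have total rate `-(π/2)(2-β) + ε(2+α+β)`; this `ε` gives back exactly half of
  -- the decay.
  set ε : ℝ := Real.pi * (2 - β) / (4 * (2 + α + β)) with hε_def
  have hε : 0 < ε := div_pos (mul_pos Real.pi_pos (by linarith)) (by positivity)
  have e : ε * (2 + α + β) = Real.pi * (2 - β) / 4 := by rw [hε_def]; field_simp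
  refine ⟨_, ?_, ((stripBound_Gamma (a := 2 + a) (b := 2 + b) (by linarith) hε).comp_affine ?_).mul <|
    ((stripBound_Gamma (a := -b) (b := -a) (by linarith) hε).comp_affine ?_).mul <|
    ((stripBound_Gamma (a := (d : ℝ) / 2 + α / 2 * a) (b := (d : ℝ) / 2 + α / 2 * b)
      (by linarith) hε).comp_affine ?_).mul <|
    ((stripBound_inv_Gamma (a := β + γ + β * a) (b := β + γ + β * b)
      (by linarith) hε).comp_affine ?_).mul <|
    ((stripBound_inv_Gamma (a := -(α / 2 * b)) (b := -(α / 2 * a))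
      (by nlinarith) hε).comp_affine ?_)⟩
  · rw [abs_one, abs_neg, abs_one, abs_neg, abs_of_pos (half_pos hα), abs_of_pos hβ]
    nlinarith [Real.pi_pos]
  all_goals
    intro x hx
    have hx1 := hx.1
    have hx2 := hx.2
    constructor <;> nlinarith

/-- Any part of the strip of convergence is free of poles. -/
theorem greenStrip_of_separates (hα : 0 < α) (hβ : 0 < β) (hγ : 0 < γ)
    (ha : -min 1 ((d : ℝ) / α) < a) (hb : b < 0) : GreenStrip α β γ d a b := by
  have h1 : -1 < a := by linarith [min_le_left 1 ((d : ℝ) / α)]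
  have h2 : -((d : ℝ) / α) < a := by linarith [min_le_right 1 ((d : ℝ) / α)]
  refine ⟨by linarith, hb, ?_, by nlinarith⟩
  have : -((d : ℝ) / α) * α < a * α := by gcongr
  rw [neg_mul, div_mul_cancel₀ _ hα.ne'] at this
  linarith

theorem differentiableOn_inv_one_add (ha : -1 < a) :
    DifferentiableOn ℂ (fun s : ℂ => (1 + s)⁻¹) {s | a ≤ s.re ∧ s.re ≤ b} := by
  refine DifferentiableOn.inv (by fun_prop) fun s hs h0 => ?_
  have := congrArg Complex.re h0
  simp at this
  linarith [hs.1]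

theorem stripBound_inv_one_add (ha : -1 < a) : StripBound (fun s : ℂ => (1 + s)⁻¹) a b 0 := by
  have h0 : 0 < 1 + a := by linarith
  refine ⟨(1 + a)⁻¹, by positivity, fun x hx y => ?_⟩
  rw [norm_inv, zero_mul, Real.exp_zero, mul_one]
  have : 1 + a ≤ ‖1 + ((x : ℂ) + y * Complex.I)‖ := by
    refine le_trans ?_ (Complex.re_le_norm _)
    simpa using hx.1
  gcongr

theorem greenSymbol_differentiableOn (hα : 0 < α) (hβ : 0 < β) (hγ : 0 < γ)
    (ha : -min 1 ((d : ℝ) / α) < a) (hb : b < 0) :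
    DifferentiableOn ℂ (greenSymbol α β γ d) {s | a ≤ s.re ∧ s.re ≤ b} :=
  ((greenStrip_of_separates hα hβ hγ ha hb).differentiableOn hα).mul
    (differentiableOn_inv_one_add (by linarith [min_le_left 1 ((d : ℝ) / α)]))

theorem greenSymbol_stripBound (hα : 0 < α) (hβ : 0 < β) (hβ2 : β < 2) (hγ : 0 < γ)
    (ha : -min 1 ((d : ℝ) / α) < a) (hb : b < 0) :
    ∃ κ < 0, StripBound (greenSymbol α β γ d) a b κ := by
  obtain ⟨κ, hκ, h⟩ := (greenStrip_of_separates hα hβ hγ ha hb).stripBound hα hβ hβ2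
  refine ⟨κ + 0, by simpa using hκ,
    h.mul (stripBound_inv_one_add (by linarith [min_le_left 1 ((d : ℝ) / α)]))⟩

/-- The value of the H-function does not depend on the separating line. -/
theorem greenH_eq_mellinInv (hα : 0 < α) (hβ : 0 < β) (hβ2 : β < 2) (hγ : 0 < γ) {c : ℝ}
    (hc : -min 1 ((d : ℝ) / α) < c) (hc0 : c < 0) {z : ℝ} (hz : 0 < z) :
    greenH α β γ d z = mellinInv c (greenSymbol α β γ d) z := by
  have shift : ∀ a b : ℝ, -min 1 ((d : ℝ) / α) < a → b < 0 → a ≤ b →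
      mellinInv a (greenSymbol α β γ d) z = mellinInv b (greenSymbol α β γ d) z := by
    intro a b ha hb hab
    obtain ⟨κ, hκ, h⟩ := greenSymbol_stripBound (d := d) hα hβ hβ2 hγ ha hb
    exact h.mellinInv_eq hκ hab (greenSymbol_differentiableOn hα hβ hγ ha hb) hz
  have hex : ∃ c, FoxSeparates 2 1 [(1, 1), (β + γ, β)]
      [((d : ℝ) / 2, α / 2), (1, 1), (1, α / 2)] c := ⟨c, (foxSeparates_green hα c).2 ⟨hc, hc0⟩⟩
  obtain ⟨h1, h2⟩ := (foxSeparates_green hα _).1 hex.choose_spec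
  rw [greenH, foxH, dif_pos hex, mellinBarnes_eq_mellinInv, foxSymbol_green]
  rcases le_total hex.choose c with h | h
  · exact shift _ _ h1 hc0 h
  · exact (shift _ _ hc h2 h).symm

theorem norm_greenH_le (hα : 0 < α) (hβ : 0 < β) (hβ2 : β < 2) (hγ : 0 < γ) {c : ℝ}
    (hc : -min 1 ((d : ℝ) / α) < c) (hc0 : c < 0) :
    ∃ C, 0 < C ∧ ∀ z : ℝ, 0 < z → ‖greenH α β γ d z‖ ≤ C * z ^ (-c) := by
  obtain ⟨κ, hκ, h⟩ := greenSymbol_stripBound (d := d) hα hβ hβ2 hγ hc hc0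
  obtain ⟨C, hC, h⟩ := h.norm_mellinInv_le hκ ⟨le_rfl, le_rfl⟩
  exact ⟨C, hC, fun z hz => by
    rw [greenH_eq_mellinInv hα hβ hβ2 hγ hc hc0 hz]; exact h z hz⟩

theorem exists_separating (hα : 0 < α) (hd : 1 ≤ d) : ∃ c : ℝ, -min 1 ((d : ℝ) / α) < c ∧ c < 0 := by
  have : 0 < (d : ℝ) / α := div_pos (by exact_mod_cast hd) hα
  exact exists_between (neg_lt_zero.2 (lt_min one_pos this))

theorem continuousOn_greenH (hα : 0 < α) (hβ : 0 < β) (hβ2 : β < 2) (hγ : 0 < γ) (hd : 1 ≤ d) :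
    ContinuousOn (greenH α β γ d) (Ioi 0) := by
  obtain ⟨c, hc, hc0⟩ := exists_separating hα hd
  obtain ⟨κ, hκ, h⟩ := greenSymbol_stripBound (d := d) hα hβ hβ2 hγ hc hc0
  exact (continuousOn_mellinInv (h.verticalIntegrable hκ
    (greenSymbol_differentiableOn hα hβ hγ hc hc0) ⟨le_rfl, le_rfl⟩)).congr fun z hz =>
      greenH_eq_mellinInv hα hβ hβ2 hγ hc hc0 hz

theorem GreenStrip.greenReg_ne_zero (h : GreenStrip α β γ d a b) (hα : 0 < α) (hβ : 0 < β)
    {x : ℝ} (hx : x ∈ Icc a b) : greenReg α β γ d x ≠ 0 := by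
  have hb := h.right
  have h1 := h.left
  have h2 := h.dim
  have h3 := h.time
  have hx1 := hx.1
  have hx2 := hx.2
  have G : ∀ p q : ℝ, 0 < p + q * x → Complex.Gamma (p + q * x) ≠ 0 := fun p q hpq =>
    Complex.Gamma_ne_zero_of_re_pos (by simpa using hpq)
  unfold greenReg
  refine mul_ne_zero (G _ _ ?_) (mul_ne_zero (G _ _ ?_) (mul_ne_zero (G _ _ ?_)
    (mul_ne_zero (inv_ne_zero (G _ _ ?_)) (inv_ne_zero (G _ _ ?_))))) <;> nlinarith

/-- If `H` vanished identically, injectivity of the inverse Mellin transform would make the symbol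
vanish on the line, yet it is nonzero at the real point `c`. -/
theorem exists_greenH_ne_zero (hα : 0 < α) (hβ : 0 < β) (hβ2 : β < 2) (hγ : 0 < γ) (hd : 1 ≤ d) :
    ∃ z : ℝ, 0 < z ∧ greenH α β γ d z ≠ 0 := by
  obtain ⟨c, hc, hc0⟩ := exists_separating hα hd
  obtain ⟨κ, hκ, h⟩ := greenSymbol_stripBound (d := d) hα hβ hβ2 hγ hc hc0
  have hd := greenSymbol_differentiableOn (d := d) hα hβ hγ hc hc0
  by_contra! h0
  have := eq_zero_of_mellinInv_eq_zero (h.verticalIntegrable hκ hd ⟨le_rfl, le_rfl⟩)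
    (continuous_vertical hd ⟨le_rfl, le_rfl⟩)
    (fun z hz => by rw [← greenH_eq_mellinInv hα hβ hβ2 hγ hc hc0 hz, h0 z hz]) 0
  rw [Complex.ofReal_zero, zero_mul, add_zero] at this
  refine mul_ne_zero ((greenStrip_of_separates hα hβ hγ hc hc0).greenReg_ne_zero hα hβ
    ⟨le_rfl, le_rfl⟩) (inv_ne_zero fun h1 => ?_) this
  have := congrArg Complex.re h1
  simp at this
  linarith [min_le_left 1 ((d : ℝ) / α)]

/-! ### Behaviour of the H-function at the origin -/

/-- The leading asymptotics of the H-function at the origin when the rightmost pole on the left of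
the contour is the simple pole at `-1`. -/
theorem greenH_asymptotics (hα : 0 < α) (hβ : 0 < β) (hβ2 : β < 2) (hγ : 0 < γ)
    (hd : α < d) : ∃ R : ℂ, R ≠ 0 ∧ ∃ δ : ℝ, 0 < δ ∧ ∃ C : ℝ, 0 < C ∧ ∀ z : ℝ, 0 < z →
      ‖greenH α β γ d z - R * ((z * Real.exp (-z) : ℝ) : ℂ)‖ ≤ C * z ^ (1 + δ) := by
  have hdα : 1 < (d : ℝ) / α := (one_lt_div hα).2 hd
  -- The three bounds keep the arguments of `Γ(2+s)`, `Γ(β+γ+βs)` and `Γ(d/2+αs/2)`, in this order,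
  -- in the right half-plane down to `Re s = -1-δ`.
  obtain ⟨δ, hδ, hδ'⟩ : ∃ δ : ℝ, 0 < δ ∧ δ < min 1 (min (γ / β) (d / α - 1)) :=
    exists_between (lt_min one_pos (lt_min (by positivity) (by linarith)))
  obtain ⟨hδ1, hδ'⟩ := lt_min_iff.1 hδ'
  obtain ⟨hδ2, hδ3⟩ := lt_min_iff.1 hδ'
  rw [lt_div_iff₀ hβ] at hδ2
  rw [lt_sub_iff_add_lt, lt_div_iff₀ hα] at hδ3
  have hS : GreenStrip α β γ d (-1 - δ) (-1 / 2) :=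
    ⟨by linarith, by norm_num, by linarith, by linarith⟩
  obtain ⟨κ₀, hκ₀, hB⟩ := hS.stripBound hα hβ hβ2
  set U : Set ℂ := {s | -1 - δ ≤ s.re ∧ s.re ≤ -1 / 2} with hU
  set R := greenReg α β γ d (-1) with hR
  have hR0 : R ≠ 0 := by
    have := hS.greenReg_ne_zero hα hβ (x := -1) ⟨by linarith, by norm_num⟩
    simpa using this
  set κ := max κ₀ (-(Real.pi / 2) + 1) with hκ_def
  have hκ : κ < 0 := max_lt hκ₀ (by linarith [Real.pi_gt_three])
  have hGB : StripBound (fun s => Complex.Gamma ((2 : ℝ) + (1 : ℝ) * s)) (-1 - δ) (-1 / 2)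
      (-(Real.pi / 2) + 1) := by
    have := (stripBound_Gamma (a := 1 - δ) (b := 3 / 2) (by linarith) one_pos).comp_affine
      (p := 2) (q := 1) (a' := -1 - δ) (b' := -1 / 2)
      fun x hx => ⟨by linarith [hx.1], by linarith [hx.2]⟩
    simpa using this
  have hGd : DifferentiableOn ℂ (fun s => Complex.Gamma ((2 : ℝ) + (1 : ℝ) * s)) U :=
    differentiableOn_Gamma_comp (by fun_prop) fun s hs => by
      have := hs.1
      simp; linarith
  -- `R` is the residue of the symbol at `-1`. Subtracting `R Γ(2+s)` creates a zero there, so the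
  -- quotient by `1+s` is holomorphic on the whole strip.
  set Q : ℂ → ℂ := fun s =>
    greenReg α β γ d s - R * Complex.Gamma ((2 : ℝ) + (1 : ℝ) * s) with hQ
  have hQB : StripBound Q (-1 - δ) (-1 / 2) κ :=
    (hB.mono_exponent (le_max_left _ _)).sub ((hGB.mono_exponent (le_max_right _ _)).const_mul R)
  have hQd : DifferentiableOn ℂ Q U :=
    (hS.differentiableOn hα).sub (hGd.const_mul R)
  have hQ0 : Q ((-1 : ℝ) : ℂ) = 0 := by
    have : ((2 : ℝ) : ℂ) + (1 : ℝ) * ((-1 : ℝ) : ℂ) = 1 := by push_cast; ring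
    simp only [hQ, this, Complex.Gamma_one, mul_one, hR]
    push_cast
    ring
  have hUn : U ∈ 𝓝 (((-1 : ℝ) : ℂ)) := by
    refine mem_of_superset ((isOpen_lt continuous_const Complex.continuous_re).inter
      (isOpen_lt Complex.continuous_re continuous_const) |>.mem_nhds
      (x := ((-1 : ℝ) : ℂ)) (s := {s | -1 - δ < s.re} ∩ {s | s.re < -1 / 2}) ⟨?_, ?_⟩)
      fun s hs => ⟨hs.1.le, hs.2.le⟩
    · simpa using hδ
    · simp; norm_num
  have hFd : DifferentiableOn ℂ (dslope Q (-1 : ℝ)) U := (Complex.differentiableOn_dslope hUn).2 hQd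
  have hFB : StripBound (dslope Q (-1 : ℝ)) (-1 - δ) (-1 / 2) κ := hQB.dslope hFd.continuousOn hQ0
  obtain ⟨C, hC, hbound⟩ := hFB.norm_mellinInv_le hκ ⟨le_rfl, by linarith⟩
  refine ⟨R, hR0, δ, hδ, C, hC, fun z hz => ?_⟩
  have hm : min 1 ((d : ℝ) / α) = 1 := min_eq_left hdα.le
  have hc : -min 1 ((d : ℝ) / α) < -1 / 2 := by rw [hm]; norm_num
  have hc0 : (-1 / 2 : ℝ) < 0 := by norm_num
  have hF : ∀ y : ℝ, dslope Q (-1 : ℝ) ((-1 / 2 : ℝ) + y * Complex.I) =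
      greenSymbol α β γ d ((-1 / 2 : ℝ) + y * Complex.I) -
        R * Complex.Gamma (1 + ((-1 / 2 : ℝ) + y * Complex.I)) := fun y => by
    rw [dslope_of_ne, slope_def_field, hQ0, sub_zero, greenSymbol, Gamma_one_add]
    · simp only [hQ]
      rw [div_eq_mul_inv, show (((-1 / 2 : ℝ) : ℂ) + y * Complex.I - ((-1 : ℝ) : ℂ)) =
        1 + (((-1 / 2 : ℝ) : ℂ) + y * Complex.I) by push_cast; ring]
      ring
    · intro h0
      have := congrArg Complex.re h0
      simp at this
      norm_num at this
  obtain ⟨κ₁, hκ₁, h₁⟩ := greenSymbol_stripBound (d := d) hα hβ hβ2 hγ hc hc0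
  have i₁ := h₁.integrable_cpow_smul hκ₁ (greenSymbol_differentiableOn hα hβ hγ hc hc0)
    ⟨le_rfl, le_rfl⟩ hz
  have i₂ := (stripBound_Gamma_one_add (a := -1 / 2) (b := -1 / 2) (by norm_num)
    one_pos).integrable_cpow_smul (by linarith [Real.pi_gt_three])
    (differentiableOn_Gamma_comp (by fun_prop) fun s hs => by
      have := hs.1
      simp; linarith) ⟨le_rfl, le_rfl⟩ hz
  have hsub : mellinInv (-1 / 2) (dslope Q (-1 : ℝ)) z =
      greenH α β γ d z - R * ((z * Real.exp (-z) : ℝ) : ℂ) := by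
    rw [greenH_eq_mellinInv hα hβ hβ2 hγ hc hc0 hz,
      ← mellinInv_Gamma_one_add (c := -1 / 2) (by norm_num) hz]
    simp only [mellinInv, hF]
    rw [Complex.real_smul, Complex.real_smul, Complex.real_smul, mul_left_comm R, ← mul_sub,
      ← integral_const_mul R,
      ← integral_sub i₁ (i₂.const_mul R)]
    congr 2
    funext y
    simp only [smul_eq_mul]
    ring
  -- With the pole gone, the line moves from `-1/2` past `-1` to `-1-δ`, which yields the error
  -- `z^(1+δ)`.
  rw [← hsub, ← hFB.mellinInv_eq hκ (by linarith) hFd hz]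
  have := hbound z hz
  rwa [show -(-1 - δ) = 1 + δ by ring] at this

end

/-! ### Self-similarity and the spatial L² norm -/

section

variable {α β γ ν : ℝ} {d : ℕ}

/-- The Green function at time `1` as a function of `‖x‖`. -/
def greenProfile (α β γ ν : ℝ) (d : ℕ) (r : ℝ) : ℝ :=
  Real.pi ^ (-(d : ℝ) / 2) * r ^ (-(d : ℝ)) * (greenH α β γ d (r ^ α / (2 ^ (α - 1) * ν))).re

/-- Self-similarity of the Green function. -/
theorem greenY_smul (hα : 0 < α) {s : ℝ} (hs : 0 < s) (x : EuclideanSpace ℝ (Fin d)) :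
    greenY α β γ ν d s (s ^ (β / α) • x) =
      s ^ (β + γ - 1 - β * d / α) * greenProfile α β γ ν d ‖x‖ := by
  have h0 := Real.rpow_nonneg hs.le (β / α)
  have hsβ := Real.rpow_pos_of_pos hs β
  rw [greenY, greenProfile, norm_smul, Real.norm_of_nonneg h0,
    Real.mul_rpow h0 (norm_nonneg x), Real.mul_rpow h0 (norm_nonneg x), ← Real.rpow_mul hs.le,
    ← Real.rpow_mul hs.le, div_mul_cancel₀ _ hα.ne', mul_comm (s ^ β),
    mul_div_mul_right _ _ hsβ.ne', sub_eq_add_neg (β + γ - 1), Real.rpow_add hs,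
    show β / α * -(d : ℝ) = -(β * d / α) by ring]
  ring

theorem lintegral_comp_smul_euclidean (f : EuclideanSpace ℝ (Fin d) → ENNReal) {c : ℝ}
    (hc : 0 < c) : ∫⁻ y, f y = ENNReal.ofReal (c ^ d) * ∫⁻ x, f (c • x) := by
  have h := (Homeomorph.smulOfNeZero c hc.ne' :
    EuclideanSpace ℝ (Fin d) ≃ₜ EuclideanSpace ℝ (Fin d)).measurableEmbedding.lintegral_map
      (μ := volume) f
  have h2 : ∫⁻ x, f (c • x) = ENNReal.ofReal |(c ^ d)⁻¹| * ∫⁻ y, f y := by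
    rw [← smul_eq_mul, ← lintegral_smul_measure]
    have := Measure.map_addHaar_smul (volume : Measure (EuclideanSpace ℝ (Fin d))) hc.ne'
    rw [finrank_euclideanSpace_fin] at this
    rw [← this]
    exact h.symm
  rw [h2, ← mul_assoc, ← ENNReal.ofReal_mul (by positivity), abs_of_pos (by positivity),
    mul_inv_cancel₀ (by positivity), ENNReal.ofReal_one, one_mul]

/-- The squared amplitude gives the exponent `2(β+γ-1-βd/α)`, and the Jacobian of the scaling
returns one `βd/α`. -/
theorem lintegral_greenY_sq (hα : 0 < α) {s : ℝ} (hs : 0 < s) :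
    ∫⁻ y : EuclideanSpace ℝ (Fin d), ENNReal.ofReal (greenY α β γ ν d s y ^ 2) =
      ENNReal.ofReal (s ^ (2 * (β + γ - 1) - β * d / α)) *
        ∫⁻ x : EuclideanSpace ℝ (Fin d), ENNReal.ofReal (greenProfile α β γ ν d ‖x‖ ^ 2) := by
  rw [lintegral_comp_smul_euclidean _ (Real.rpow_pos_of_pos hs (β / α))]
  simp only [greenY_smul hα hs, mul_pow]
  have h1 : 0 ≤ (s ^ (β + γ - 1 - β * d / α)) ^ 2 := sq_nonneg _
  simp only [ENNReal.ofReal_mul h1]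
  rw [lintegral_const_mul' _ _ ENNReal.ofReal_ne_top, ← mul_assoc,
    ← ENNReal.ofReal_mul (by positivity)]
  congr 2
  rw [← Real.rpow_natCast, ← Real.rpow_natCast, ← Real.rpow_mul hs.le, ← Real.rpow_mul hs.le,
    ← Real.rpow_add hs]
  congr 1
  push_cast
  ring

theorem abs_greenH_re {z : ℝ} (hz : 0 ≤ z) : |(greenH α β γ d z).re| = ‖greenH α β γ d z‖ :=
  Complex.abs_re_eq_norm.2 (greenH_im α β γ d z hz)

theorem continuousOn_greenProfile (hα : 0 < α) (hβ : 0 < β) (hβ2 : β < 2) (hγ : 0 < γ)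
    (hν : 0 < ν) (hd : 1 ≤ d) : ContinuousOn (greenProfile α β γ ν d) (Ioi 0) := by
  have h1 : ContinuousOn (fun r : ℝ => r ^ (-(d : ℝ))) (Ioi 0) := fun r hr =>
    (Real.continuousAt_rpow_const r _ (Or.inl (mem_Ioi.1 hr).ne')).continuousWithinAt
  have h2 : ContinuousOn (fun r : ℝ => r ^ α / (2 ^ (α - 1) * ν)) (Ioi 0) := fun r hr =>
    ((Real.continuousAt_rpow_const r _ (Or.inl (mem_Ioi.1 hr).ne')).div_const _).continuousWithinAt
  exact (continuousOn_const.mul h1).mul (Complex.continuous_re.comp_continuousOn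
    ((continuousOn_greenH hα hβ hβ2 hγ hd).comp h2 fun r hr =>
      div_pos (Real.rpow_pos_of_pos hr _) (by positivity)))

theorem continuousOn_greenProfile_norm (hα : 0 < α) (hβ : 0 < β) (hβ2 : β < 2) (hγ : 0 < γ)
    (hν : 0 < ν) (hd : 1 ≤ d) :
    ContinuousOn (fun x : EuclideanSpace ℝ (Fin d) => greenProfile α β γ ν d ‖x‖) {0}ᶜ :=
  (continuousOn_greenProfile hα hβ hβ2 hγ hν hd).comp continuous_norm.continuousOn
    fun _ hx => norm_pos_iff.2 hx

theorem aestronglyMeasurable_greenProfile_norm (hα : 0 < α) (hβ : 0 < β) (hβ2 : β < 2)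
    (hγ : 0 < γ) (hν : 0 < ν) (hd : 1 ≤ d) :
    AEStronglyMeasurable (fun x : EuclideanSpace ℝ (Fin d) => greenProfile α β γ ν d ‖x‖) := by
  have : Nonempty (Fin d) := ⟨⟨0, hd⟩⟩
  have h := (continuousOn_greenProfile_norm hα hβ hβ2 hγ hν hd).aestronglyMeasurable
    (μ := volume) (measurableSet_singleton _).compl
  rwa [restrict_compl_singleton] at h

/-- Excludes the degenerate product `∞ · 0`. A vanishing integral would force the profile,
continuous off the origin, to vanish there identically, hence also `H` on `(0, ∞)`. -/
theorem lintegral_greenProfile_ne_zero (hα : 0 < α) (hβ : 0 < β) (hβ2 : β < 2)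
    (hγ : 0 < γ) (hν : 0 < ν) (hd : 1 ≤ d) :
    ∫⁻ x : EuclideanSpace ℝ (Fin d), ENNReal.ofReal (greenProfile α β γ ν d ‖x‖ ^ 2) ≠ 0 := by
  have : Nonempty (Fin d) := ⟨⟨0, hd⟩⟩
  intro h0
  rw [lintegral_eq_zero_iff' ((aestronglyMeasurable_greenProfile_norm hα hβ hβ2 hγ hν
    hd).aemeasurable.pow_const 2).ennreal_ofReal] at h0
  have h1 : (fun x : EuclideanSpace ℝ (Fin d) => greenProfile α β γ ν d ‖x‖)
      =ᵐ[volume.restrict {0}ᶜ] fun _ => 0 := by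
    refine ae_restrict_of_ae ?_
    filter_upwards [h0] with x hx
    have : greenProfile α β γ ν d ‖x‖ ^ 2 ≤ 0 := ENNReal.ofReal_eq_zero.1 hx
    exact pow_eq_zero_iff two_ne_zero |>.1 (le_antisymm this (sq_nonneg _))
  have h2 := Measure.eqOn_open_of_ae_eq h1 isOpen_compl_singleton
    (continuousOn_greenProfile_norm hα hβ hβ2 hγ hν hd) continuousOn_const
  obtain ⟨z, hz, hHz⟩ := exists_greenH_ne_zero (α := α) (β := β) (γ := γ) hα hβ hβ2 hγ hd
  have hK : 0 < 2 ^ (α - 1) * ν := by positivity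
  have hr : 0 < (z * (2 ^ (α - 1) * ν)) ^ (1 / α) := Real.rpow_pos_of_pos (by positivity) _
  obtain ⟨x, hx⟩ := exists_norm_eq (EuclideanSpace ℝ (Fin d)) hr.le
  have h3 := h2 (x := x) fun h => by
    rw [mem_singleton_iff.1 h, norm_zero] at hx
    exact hr.ne hx
  have h4 : ‖x‖ ^ α / (2 ^ (α - 1) * ν) = z := by
    rw [hx, ← Real.rpow_mul (by positivity), one_div_mul_cancel hα.ne', Real.rpow_one,
      mul_div_cancel_right₀ _ hK.ne']
  simp only [greenProfile, h4, mul_eq_zero] at h3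
  refine hHz (norm_eq_zero.1 ?_)
  rw [← abs_greenH_re hz.le, abs_eq_zero]
  refine h3.resolve_left fun h => h.elim ?_ ?_
  · exact (Real.rpow_pos_of_pos Real.pi_pos _).ne'
  · rw [hx]; exact (Real.rpow_pos_of_pos hr _).ne'

/-- The spatial `L²` norm in polar coordinates. -/
theorem lintegral_greenProfile_lt_top_iff (hα : 0 < α) (hβ : 0 < β) (hβ2 : β < 2)
    (hγ : 0 < γ) (hν : 0 < ν) (hd : 1 ≤ d) :
    ∫⁻ x : EuclideanSpace ℝ (Fin d), ENNReal.ofReal (greenProfile α β γ ν d ‖x‖ ^ 2) < ⊤ ↔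
      IntegrableOn (fun r => r ^ (d - 1) * greenProfile α β γ ν d r ^ 2) (Ioi 0) := by
  have : Nonempty (Fin d) := ⟨⟨0, hd⟩⟩
  have h := integrable_fun_norm_addHaar (volume : Measure (EuclideanSpace ℝ (Fin d)))
    (f := fun r => greenProfile α β γ ν d r ^ 2)
  simp only [finrank_euclideanSpace_fin, smul_eq_mul] at h
  rw [← h, Integrable, hasFiniteIntegral_iff_ofReal (Eventually.of_forall fun x => sq_nonneg _)]
  exact (and_iff_right ((aestronglyMeasurable_greenProfile_norm hα hβ hβ2 hγ hν hd).pow 2)).symm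

theorem weighted_greenProfile_sq {r : ℝ} (hr : 0 < r) (hν : 0 < ν) (hd : 1 ≤ d) :
    r ^ (d - 1) * greenProfile α β γ ν d r ^ 2 = Real.pi ^ (-(d : ℝ)) *
      r ^ (-(d : ℝ) - 1) * ‖greenH α β γ d (r ^ α / (2 ^ (α - 1) * ν))‖ ^ 2 := by
  rw [greenProfile, ← abs_greenH_re (by positivity), sq_abs, mul_pow, mul_pow,
    ← Real.rpow_natCast, ← Real.rpow_natCast (Real.pi ^ _), ← Real.rpow_mul Real.pi_pos.le,
    ← Real.rpow_natCast (r ^ _), ← Real.rpow_mul hr.le, ← mul_assoc, mul_left_comm,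
    ← Real.rpow_add hr, Nat.cast_sub hd]
  congr 3 <;> push_cast <;> ring

theorem weighted_greenProfile_sq_le (hα : 0 < α) (hβ : 0 < β) (hβ2 : β < 2)
    (hγ : 0 < γ) (hν : 0 < ν) (hd : 1 ≤ d) {c : ℝ} (hc : -min 1 ((d : ℝ) / α) < c) (hc0 : c < 0) :
    ∃ C : ℝ, ∀ r : ℝ, 0 < r →
      ‖r ^ (d - 1) * greenProfile α β γ ν d r ^ 2‖ ≤ C * r ^ (-(d : ℝ) - 1 - 2 * α * c) := by
  obtain ⟨C, hC, h⟩ := norm_greenH_le hα hβ hβ2 hγ hc hc0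
  set K : ℝ := 2 ^ (α - 1) * ν
  have hK : 0 < K := by positivity
  refine ⟨Real.pi ^ (-(d : ℝ)) * (C * (K ^ (-c))⁻¹) ^ 2, fun r hr => ?_⟩
  have h1 := h (r ^ α / K) (by positivity)
  rw [Real.div_rpow (by positivity) hK.le, ← Real.rpow_mul hr.le] at h1
  rw [Real.norm_of_nonneg (by positivity), weighted_greenProfile_sq hr hν hd]
  calc _ ≤ Real.pi ^ (-(d : ℝ)) * r ^ (-(d : ℝ) - 1) * (C * (r ^ (α * -c) / K ^ (-c))) ^ 2 := by
        gcongr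
    _ = Real.pi ^ (-(d : ℝ)) * (C * (K ^ (-c))⁻¹) ^ 2 *
        (r ^ (-(d : ℝ) - 1) * (r ^ (α * -c)) ^ (2 : ℕ)) := by ring
    _ = _ := by
        rw [← Real.rpow_natCast (r ^ _), ← Real.rpow_mul hr.le, ← Real.rpow_add hr]
        congr 2
        push_cast
        ring

theorem integrableOn_weighted_greenProfile_sq (hα : 0 < α) (hβ : 0 < β) (hβ2 : β < 2)
    (hγ : 0 < γ) (hν : 0 < ν) (hd : 1 ≤ d) (hdα : (d : ℝ) < 2 * α) :
    IntegrableOn (fun r => r ^ (d - 1) * greenProfile α β γ ν d r ^ 2) (Ioi 0) := by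
  have hd0 : (0 : ℝ) < d := by exact_mod_cast hd
  have h0 : 0 < (d : ℝ) / α := by positivity
  -- At `c = -d/(2α)` the majorant `r^(-d-1-2αc)` is exactly `r^(-1)`. The condition `d < 2α` puts
  -- this value inside the strip, leaving room for `c₁` (convergence at `0`) and `c₂` (convergence
  -- at `∞`).
  have hσ : -min 1 ((d : ℝ) / α) < -((d : ℝ) / α / 2) := by
    have : (d : ℝ) / α < 2 := (div_lt_iff₀ hα).2 hdα
    exact neg_lt_neg (lt_min (by linarith) (by linarith))
  obtain ⟨c₁, hc₁, hc₁'⟩ := exists_between hσ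
  obtain ⟨c₂, hc₂, hc₂'⟩ := exists_between (show -((d : ℝ) / α / 2) < 0 by linarith)
  obtain ⟨C₁, h₁⟩ := weighted_greenProfile_sq_le hα hβ hβ2 hγ hν hd hc₁ (by linarith)
  obtain ⟨C₂, h₂⟩ := weighted_greenProfile_sq_le hα hβ hβ2 hγ hν hd (hσ.trans hc₂) hc₂'
  have e : α * ((d : ℝ) / α / 2) = d / 2 := by field_simp
  have e₁ : α * c₁ < α * -((d : ℝ) / α / 2) := by gcongr
  have e₂ : α * -((d : ℝ) / α / 2) < α * c₂ := by gcongr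
  have hcont : ContinuousOn (fun r => r ^ (d - 1) * greenProfile α β γ ν d r ^ 2) (Ioi 0) :=
    (continuous_pow _).continuousOn.mul ((continuousOn_greenProfile hα hβ hβ2 hγ hν hd).pow 2)
  rw [← Ioo_union_Ici_eq_Ioi (zero_lt_one' ℝ), integrableOn_union, integrableOn_Ici_iff_integrableOn_Ioi]
  constructor
  · refine Integrable.mono' (g := fun r => C₁ * r ^ (-(d : ℝ) - 1 - 2 * α * c₁))
      (((intervalIntegral.integrableOn_Ioo_rpow_iff one_pos).2 (by linarith)).const_mul C₁)
      ((hcont.mono Ioo_subset_Ioi_self).aestronglyMeasurable measurableSet_Ioo) ?_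
    exact (ae_restrict_iff' measurableSet_Ioo).2 (Eventually.of_forall fun r hr => h₁ r hr.1)
  · refine Integrable.mono' (g := fun r => C₂ * r ^ (-(d : ℝ) - 1 - 2 * α * c₂))
      (((integrableOn_Ioi_rpow_iff one_pos).2 (by linarith)).const_mul C₂)
      ((hcont.mono (Ioi_subset_Ioi zero_le_one)).aestronglyMeasurable measurableSet_Ioi) ?_
    exact (ae_restrict_iff' measurableSet_Ioi).2
      (Eventually.of_forall fun r hr => h₂ r (zero_lt_one.trans hr))

/-- The leading term `R z exp(-z)` dominates the error `z^(1+δ)` as `z → 0`. -/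
theorem greenH_lower_bound (hα : 0 < α) (hβ : 0 < β) (hβ2 : β < 2) (hγ : 0 < γ) (hd : α < d) :
    ∃ m : ℝ, 0 < m ∧ ∀ᶠ z in 𝓝[>] (0 : ℝ), m * z ≤ ‖greenH α β γ d z‖ := by
  obtain ⟨R, hR, δ, hδ, C, hC, h⟩ := greenH_asymptotics hα hβ hβ2 hγ hd
  have hR' := norm_pos_iff.2 hR
  have ht : Tendsto (fun z : ℝ => ‖R‖ * Real.exp (-z) - C * z ^ δ) (𝓝[>] 0) (𝓝 ‖R‖) := by
    have h1 : ContinuousAt (fun z : ℝ => ‖R‖ * Real.exp (-z) - C * z ^ δ) 0 :=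
      ContinuousAt.sub (by fun_prop)
        (continuousAt_const.mul (Real.continuousAt_rpow_const 0 δ (Or.inr hδ.le)))
    have h2 := h1.tendsto
    simp only [neg_zero, Real.exp_zero, mul_one, Real.zero_rpow hδ.ne', mul_zero, sub_zero] at h2
    exact h2.mono_left nhdsWithin_le_nhds
  refine ⟨‖R‖ / 2, by positivity, ?_⟩
  filter_upwards [ht.eventually_const_le (half_lt_self hR'), self_mem_nhdsWithin] with z hz hz0
  have hz0' : 0 < z := hz0
  have h1 := h z hz0
  have h2 : ‖R * ((z * Real.exp (-z) : ℝ) : ℂ)‖ = ‖R‖ * Real.exp (-z) * z := by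
    rw [norm_mul, Complex.norm_real, Real.norm_of_nonneg (by positivity)]; ring
  have h3 := norm_sub_norm_le (R * ((z * Real.exp (-z) : ℝ) : ℂ)) (greenH α β γ d z)
  rw [norm_sub_rev, h2] at h3
  have h4 : z ^ (1 + δ) = z ^ δ * z := by rw [add_comm, Real.rpow_add hz0', Real.rpow_one]
  rw [h4] at h1
  nlinarith

theorem not_integrableOn_weighted_greenProfile_sq (hα : 0 < α) (hβ : 0 < β) (hβ2 : β < 2)
    (hγ : 0 < γ) (hν : 0 < ν) (hd : 1 ≤ d) (hdα : 2 * α ≤ d) :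
    ¬IntegrableOn (fun r => r ^ (d - 1) * greenProfile α β γ ν d r ^ 2) (Ioi 0) := by
  intro hint
  obtain ⟨m, hm, hlow⟩ := greenH_lower_bound hα hβ hβ2 hγ (d := d) (by linarith)
  set K : ℝ := 2 ^ (α - 1) * ν
  have hK : 0 < K := by positivity
  have ht : Tendsto (fun r : ℝ => r ^ α / K) (𝓝[>] 0) (𝓝[>] 0) := by
    refine tendsto_nhdsWithin_iff.2 ⟨?_, ?_⟩
    · have := ((Real.continuousAt_rpow_const 0 α (Or.inr hα.le)).div_const K).tendsto
      simp only [Real.zero_rpow hα.ne', zero_div] at this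
      exact this.mono_left nhdsWithin_le_nhds
    · filter_upwards [self_mem_nhdsWithin] with r hr
      exact div_pos (Real.rpow_pos_of_pos hr _) hK
  obtain ⟨r₀, hr₀, hsub⟩ := mem_nhdsGT_iff_exists_Ioo_subset.1 (ht.eventually hlow)
  have hr₀' : 0 < r₀ := hr₀
  set D : ℝ := Real.pi ^ (-(d : ℝ)) * (m / K) ^ 2
  have hD : 0 < D := by positivity
  -- The lower bound on `H` would make `r^(-d-1+2α)` integrable at `0`, which requires `d < 2α`.
  have hI : IntegrableOn (fun r : ℝ => r ^ (-(d : ℝ) - 1 + 2 * α)) (Ioo 0 r₀) := by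
    refine Integrable.mono' ((hint.mono_set Ioo_subset_Ioi_self).const_mul D⁻¹)
      (ContinuousOn.aestronglyMeasurable (fun r hr => (Real.continuousAt_rpow_const r _
        (Or.inl hr.1.ne')).continuousWithinAt) measurableSet_Ioo) ?_
    refine (ae_restrict_iff' measurableSet_Ioo).2 (Eventually.of_forall fun r hr => ?_)
    have hr0 := hr.1
    have h1 : m * (r ^ α / K) ≤ ‖greenH α β γ d (r ^ α / K)‖ := hsub hr
    rw [Real.norm_of_nonneg (by positivity), weighted_greenProfile_sq hr0 hν hd,
      inv_mul_eq_div, le_div_iff₀ hD]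
    calc _ = Real.pi ^ (-(d : ℝ)) * r ^ (-(d : ℝ) - 1) * (m * (r ^ α / K)) ^ 2 := by
          rw [Real.rpow_add hr0, mul_comm 2 α, Real.rpow_mul hr0.le, Real.rpow_two]
          ring
      _ ≤ _ := by gcongr
  rw [intervalIntegral.integrableOn_Ioo_rpow_iff hr₀'] at hI
  linarith

/-! ### The time integral and the conclusion -/

theorem lintegral_rpow_lt_top_iff {t ρ : ℝ} (ht : 0 < t) :
    ∫⁻ s in Ioo 0 t, ENNReal.ofReal (s ^ ρ) < ⊤ ↔ -1 < ρ := by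
  rw [← intervalIntegral.integrableOn_Ioo_rpow_iff ht, IntegrableOn, Integrable,
    hasFiniteIntegral_iff_ofReal]
  · exact (and_iff_right (ContinuousOn.aestronglyMeasurable (fun r hr =>
      (Real.continuousAt_rpow_const r _ (Or.inl hr.1.ne')).continuousWithinAt)
        measurableSet_Ioo)).symm
  · exact (ae_restrict_iff' measurableSet_Ioo).2
      (Eventually.of_forall fun r hr => Real.rpow_nonneg hr.1.le _)

theorem lintegral_rpow_ne_zero {t ρ : ℝ} (ht : 0 < t) :
    ∫⁻ s in Ioo 0 t, ENNReal.ofReal (s ^ ρ) ≠ 0 := by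
  refine ((setLIntegral_pos_iff (by fun_prop)).2 ?_).ne'
  have : Ioo 0 t ⊆ (Function.support fun s : ℝ => ENNReal.ofReal (s ^ ρ)) ∩ Ioo 0 t :=
    fun s hs => ⟨(ENNReal.ofReal_pos.2 (Real.rpow_pos_of_pos hs.1 _)).ne', hs⟩
  exact lt_of_lt_of_le (by simpa using ht) (measure_mono this)

end
end

theorem mainTheorem8 (α β γ ν : ℝ) (d : ℕ) (hα : 0 < α) (hα2 : α ≤ 2) (hβ : 0 < β) (hβ2 : β < 2)
    (hγ : 0 < γ) (hν : 0 < ν) (hd : 1 ≤ d) :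
    (d : ℝ) < 2 * α + α / β * min (2 * γ - 1) 0 ↔
      ∀ t : ℝ, 0 < t →
        (∫⁻ s in Set.Ioo 0 t, ∫⁻ y : EuclideanSpace ℝ (Fin d),
          ENNReal.ofReal (greenY α β γ ν d s y ^ 2)) < ⊤ := by
  set A := ∫⁻ x : EuclideanSpace ℝ (Fin d), ENNReal.ofReal (greenProfile α β γ ν d ‖x‖ ^ 2) with hA
  have hA0 : A ≠ 0 := lintegral_greenProfile_ne_zero hα hβ hβ2 hγ hν hd
  have hAtop : A < ⊤ ↔ (d : ℝ) < 2 * α := by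
    rw [hA, lintegral_greenProfile_lt_top_iff hα hβ hβ2 hγ hν hd]
    refine ⟨fun h => ?_, integrableOn_weighted_greenProfile_sq hα hβ hβ2 hγ hν hd⟩
    by_contra! h'
    exact not_integrableOn_weighted_greenProfile_sq hα hβ hβ2 hγ hν hd h' h
  have hint : ∀ t : ℝ, 0 < t → ((∫⁻ s in Set.Ioo 0 t, ∫⁻ y : EuclideanSpace ℝ (Fin d),
      ENNReal.ofReal (greenY α β γ ν d s y ^ 2)) < ⊤ ↔
        -1 < 2 * (β + γ - 1) - β * d / α ∧ (d : ℝ) < 2 * α) := fun t ht => by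
    rw [setLIntegral_congr_fun measurableSet_Ioo fun s hs => lintegral_greenY_sq hα hs.1,
      lintegral_mul_const _ (by fun_prop), ENNReal.mul_lt_top_iff, lintegral_rpow_lt_top_iff ht,
      hAtop]
    -- A product in `[0, ∞]` is also finite when one factor is zero; both factors are nonzero here.
    simp only [← hA, hA0, lintegral_rpow_ne_zero ht, or_false]
  have hiff : (d : ℝ) < 2 * α + α / β * min (2 * γ - 1) 0 ↔
      -1 < 2 * (β + γ - 1) - β * d / α ∧ (d : ℝ) < 2 * α := by
    have hαβ : 0 < α / β := div_pos hα hβ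
    rw [mul_min_of_nonneg _ _ hαβ.le, mul_zero, ← min_add_add_left, lt_min_iff, add_zero]
    refine and_congr_left fun _ => ?_
    -- The excess of the time exponent over `-1` is a positive multiple of the gap in the first
    -- inequality contained in the minimum.
    have e : 2 * (β + γ - 1) - β * d / α + 1 =
        β / α * (2 * α + α / β * (2 * γ - 1) - d) := by
      field_simp
      ring
    have hβα : 0 < β / α := div_pos hβ hα
    rw [neg_lt_iff_pos_add, e, mul_pos_iff_of_pos_left hβα, sub_pos]
  rw [hiff]
  exact ⟨fun h t ht => (hint t ht).2 h, fun h => (hint 1 one_pos).1 (h 1 one_pos)⟩
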